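/- **Setup.** Let $d_X\ge 1$, let $\Theta\subseteq\mathbb R^d$, let $m:\mathbb R^{d_W}\times\Theta\to\mathbb R^{d_Y}$ be measurable, let $P$ be a probability measure on $\mathbb R^{d_X}\times\mathbb R^{d_W}$, and let $(X_1,W_1),(X_2,W_2),\dots$ be i.i.d. with law $P$, defined on a probability space with probability $\Pr$. Let $\mathcal G$ be a class of functions $g=(g_1,\dots,g_{d_Y}):\mathbb R^{d_X}\to[0,\infty)^{d_Y}$ (a class of scalar functions is included by taking $g_1=\dots=g_{d_Y}$). The identified set $\Theta_0(P)$ is the set of $\theta\in\Theta$ such that, for every $j$, $m_j(W_i,\theta)$ is integrable and $E_P[m_j(W_i,\theta)\mid X_i]\ge 0$ $P$-a.s. With $E_n$ the sample mean over the first $n$ observations, put $$\hat\mu_{n,j}(\theta,g)=E_n\,m_j(W_i,\theta)g_j(X_i),\qquad \hat\sigma_{n,j}(\theta,g)=\bigl\{E_n[m_j(W_i,\theta)g_j(X_i)]^2-[E_n\,m_j(W_i,\theta)g_j(X_i)]^2\bigr\}^{1/2},$$ and, for real (possibly data-dependent) truncation points $\sigma_n$ and a function $S:\mathbb R^{d_Y}\to[0,\infty)$,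 $$T_n(\theta)=\sup_{g\in\mathcal G}S\left(\frac{\hat\mu_{n,1}(\theta,g)}{\hat\sigma_{n,1}(\theta,g)\vee\sigma_n},\dots,\frac{\hat\mu_{n,d_Y}(\theta,g)}{\hat\sigma_{n,d_Y}(\theta,g)\vee\sigma_n}\right)\in[0,\infty]$$ (a quotient with denominator $0$, which does not occur if $\sigma_n>0$, is read as $0$). **Assumption on $S$.** (i) $S(t)>0$ if and only if $t_j<0$ for some $j$; (ii) there are constants $K_1,K_2>0$ such that for all $c>0$ and all $t$: $S(t)\ge c$ implies $t_j\le -cK_1$ for some $j$, and $S(t)\le c$ implies $t_j\ge -cK_2$ for all $j$. **Assumption on $\theta$.** $\theta\in\Theta_0(P)$, and for some $j$ and some nonempty open set $\mathcal X\subseteq\mathbb R^{d_X}$: (i) $E_P[m_j(W_i,\theta)\mid X_i]=0$ a.s. on $\{X_i\in\mathcal X\}$, and on $\mathcal X$ the law of $X_i$ has a Lebesgue density that is bounded from above and bounded away from zero; (ii) $\mathrm{var}_P(m_j(W_i,\theta)\mid X_i=x)$ has a version that is continuous on $\mathcal X$, and bounded and bounded away from zero there; (iii) for some measurable $k:\mathbb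 R^{d_X}\to[0,\infty)$ that is bounded, has bounded support, integrates to one, is square integrable, is bounded away from zero in a neighborhood of $0$ and is continuous at $0$, and for some $\bar h>0$, the class $\mathcal G$ contains the function $t\mapsto k((t-x)/h)$ (that is, some $g\in\mathcal G$ with $g_j(t)=k((t-x)/h)$ for all $t$) for all $x\in\mathbb R^{d_X}$ and all $0<h<\bar h$. **Theorem.** Under these assumptions, if $\sigma_n\to 0$ (in probability, when $\sigma_n$ is data-dependent), then $\sqrt n\,T_n(\theta)$ diverges to $\infty$ in probability: for every $M\in\mathbb R$, $\Pr(\sqrt n\,T_n(\theta)\le M)\to 0$ as $n\to\infty$ (in outer probability, should measurability fail). -/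

import Mathlib

open MeasureTheory ProbabilityTheory Filter Topology
open scoped NNReal ENNReal

noncomputable section

namespace MomentIneq

/-- `ℝ^d` with the Euclidean norm. -/
abbrev Vec (d : ℕ) : Type := EuclideanSpace ℝ (Fin d)

section Conditional

variable {dX dW : ℕ}

/-- A version of `x ↦ E_P[f(W) | X = x]`, where `P` is the joint law of `(X, W)`: the mean of `f`
under the regular conditional distribution of `W` given `X = x`. -/
def condMean (P : Measure (Vec dX × Vec dW)) [IsFiniteMeasure P] (f : Vec dW → ℝ)
    (x : Vec dX) : ℝ :=
  ∫ w, f w ∂(P.condKernel x)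

/-- A version of `x ↦ var_P(f(W) | X = x)`, where `P` is the joint law of `(X, W)`: the variance
of `f` under the regular conditional distribution of `W` given `X = x`. -/
def condVariance (P : Measure (Vec dX × Vec dW)) [IsFiniteMeasure P] (f : Vec dW → ℝ)
    (x : Vec dX) : ℝ :=
  variance f (P.condKernel x)

/-- `condMean` composed with `X` is Mathlib's conditional expectation given `σ(X)`. -/
theorem condExp_ae_eq_condMean (P : Measure (Vec dX × Vec dW)) [IsProbabilityMeasure P]
    {f : Vec dW → ℝ} (hf : Integrable (fun z : Vec dX × Vec dW => f z.2) P) :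
    P[fun z : Vec dX × Vec dW => f z.2 | MeasurableSpace.comap Prod.fst inferInstance]
      =ᵐ[P] fun z => condMean P f z.1 := by
  have h := condExp_prod_ae_eq_integral_condDistrib' (μ := P)
    (X := (Prod.fst : Vec dX × Vec dW → Vec dX)) (Y := (Prod.snd : Vec dX × Vec dW → Vec dW))
    (f := fun z => f z.2) measurable_fst measurable_snd.aemeasurable (by simpa using hf)
  have hk : condDistrib (Prod.snd : Vec dX × Vec dW → Vec dW) Prod.fst P = P.condKernel := by
    simp [condDistrib]
  rw [hk] at h
  exact h

end Conditional

section Model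

variable {dX dW dY d : ℕ} {Θ : Set (Vec d)}

/-- The identified set `Θ₀(P)`: the parameters `θ ∈ Θ` with `E_P[m(W, θ) | X] ≥ 0` `P`-a.s.
(componentwise), the conditional expectation being that of an integrable function. -/
def identifiedSet (P : Measure (Vec dX × Vec dW)) [IsFiniteMeasure P]
    (m : Vec dW × Θ → Fin dY → ℝ) : Set Θ :=
  {θ | ∀ j, Integrable (fun z : Vec dX × Vec dW => m (z.2, θ) j) P ∧
    ∀ᵐ x ∂P.fst, 0 ≤ condMean P (fun w => m (w, θ) j) x}

/-- The sample mean `E_n f = (1/n) ∑ f(z_i)` over the first `n` observations. -/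
def sampleMean {Z : Type*} (n : ℕ) (z : ℕ → Z) (f : Z → ℝ) : ℝ :=
  (∑ i ∈ Finset.range n, f (z i)) / n

/-- `μ̂_{n,j}(θ,g) = E_n m_j(W_i,θ) g_j(X_i)`. -/
def muHat (m : Vec dW × Θ → Fin dY → ℝ) (n : ℕ) (z : ℕ → Vec dX × Vec dW) (θ : Θ)
    (g : Vec dX → Fin dY → ℝ≥0) (j : Fin dY) : ℝ :=
  sampleMean n z (fun p => m (p.2, θ) j * g p.1 j)

/-- `σ̂_{n,j}(θ,g) = {E_n [m_j(W_i,θ) g_j(X_i)]² - [E_n m_j(W_i,θ) g_j(X_i)]²}^{1/2}`. -/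
def sigmaHat (m : Vec dW × Θ → Fin dY → ℝ) (n : ℕ) (z : ℕ → Vec dX × Vec dW) (θ : Θ)
    (g : Vec dX → Fin dY → ℝ≥0) (j : Fin dY) : ℝ :=
  Real.sqrt (sampleMean n z (fun p => (m (p.2, θ) j * g p.1 j) ^ 2) -
    (sampleMean n z (fun p => m (p.2, θ) j * g p.1 j)) ^ 2)

/-- The variance weighted KS statistic `T_n(θ)` computed from the first `n` observations with
truncation point `s`. The supremum is taken in `[0, ∞]`. -/
def ksStat (m : Vec dW × Θ → Fin dY → ℝ) (G : Set (Vec dX → Fin dY → ℝ≥0))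
    (S : (Fin dY → ℝ) → ℝ≥0) (s : ℝ) (n : ℕ) (z : ℕ → Vec dX × Vec dW) (θ : Θ) : ℝ≥0∞ :=
  ⨆ g ∈ G, (S (fun j => muHat m n z θ g j / max (sigmaHat m n z θ g j) s) : ℝ≥0∞)

/-- The conditions on the function `S` that aggregates the weighted moments. -/
structure SAssumption (S : (Fin dY → ℝ) → ℝ≥0) : Prop where
  pos_iff : ∀ t, 0 < S t ↔ ∃ j, t j < 0
  scale : ∃ K₁ K₂ : ℝ, 0 < K₁ ∧ 0 < K₂ ∧ ∀ c : ℝ, 0 < c → ∀ t,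
    (c ≤ S t → ∃ j, t j ≤ -(c * K₁)) ∧ ((S t : ℝ) ≤ c → ∀ j, -(c * K₂) ≤ t j)

/-- The conditions on the (nonnegative) kernel function `k`. -/
structure KernelAssumption (k : Vec dX → ℝ≥0) : Prop where
  measurable : Measurable k
  integrable : Integrable (fun t => (k t : ℝ))
  integral_eq_one : ∫ t, (k t : ℝ) = 1
  bounded : ∃ B : ℝ≥0, ∀ t, k t ≤ B
  sq_integrable : Integrable (fun t => (k t : ℝ) ^ 2)
  bounded_below : ∃ δ : ℝ≥0, 0 < δ ∧ ∀ᶠ t in 𝓝 (0 : Vec dX), δ ≤ k t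
  bounded_support : Bornology.IsBounded (Function.support k)
  continuousAt_zero : ContinuousAt k 0

/-- The contact set condition at the parameter `θ`, for the moment `j` and the open set `U`. -/
structure ContactSetAt (P : Measure (Vec dX × Vec dW)) [IsFiniteMeasure P]
    (m : Vec dW × Θ → Fin dY → ℝ) (G : Set (Vec dX → Fin dY → ℝ≥0)) (θ : Θ) (j : Fin dY)
    (U : Set (Vec dX)) : Prop where
  isOpen : IsOpen U
  nonempty : U.Nonempty
  condMean_eq_zero : ∀ᵐ x ∂P.fst, x ∈ U → condMean P (fun w => m (w, θ) j) x = 0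
  density : ∃ f : Vec dX → ℝ, Measurable f ∧
    P.fst.restrict U = (volume.restrict U).withDensity (fun x => ENNReal.ofReal (f x)) ∧
    ∃ a b : ℝ, 0 < a ∧ ∀ x ∈ U, a ≤ f x ∧ f x ≤ b
  condVar_bounds : ∃ v : Vec dX → ℝ, ContinuousOn v U ∧
    (∀ᵐ x ∂P.fst, x ∈ U → condVariance P (fun w => m (w, θ) j) x = v x) ∧
    ∃ a b : ℝ, 0 < a ∧ ∀ x ∈ U, a ≤ v x ∧ v x ≤ b
  kernel_mem : ∃ k : Vec dX → ℝ≥0, KernelAssumption k ∧ ∃ h₀ : ℝ, 0 < h₀ ∧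
    ∀ (x : Vec dX) (h : ℝ), 0 < h → h < h₀ →
      ∃ g ∈ G, ∀ t, g t j = k (h⁻¹ • (t - x))

/-- The contact set condition: `θ` is in the identified set and the contact set condition holds
for some moment `j` and some open set `U`. -/
def ContactSetAssumption (P : Measure (Vec dX × Vec dW)) [IsFiniteMeasure P]
    (m : Vec dW × Θ → Fin dY → ℝ) (G : Set (Vec dX → Fin dY → ℝ≥0)) (θ : Θ) : Prop :=
  θ ∈ identifiedSet P m ∧ ∃ (j : Fin dY) (U : Set (Vec dX)), ContactSetAt P m G θ j U

end Model

end MomentIneq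

end

namespace MomentIneq

/-! ### Central limit theorem and sample variances. -/

section CentralLimit

variable {Ω 𝒵 : Type*} [MeasurableSpace Ω] [MeasurableSpace 𝒵] {μ : Measure Ω}
  {P : Measure 𝒵} {Z : ℕ → Ω → 𝒵}

/-! Only finitely many weights, fixed as `n` grows, are needed. Place `N` small dilated kernels on
disjoint balls inside the contact set. Each weighted moment has mean zero there and a finite
positive variance, and disjoint supports make the moments uncorrelated, so after rescaling they are
orthonormal in `L²(P)` (`ContactSetAt.exists_orthonormal`). If `√n T_n ≤ M`, the scale condition on
`S` bounds every studentised moment below by a multiple of `-1/√n`. The sample variances converge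
and the truncation point falls below the fixed standard deviations, so outside an event of vanishing
probability all `N` normalised sums are at least `-C`, with `C` independent of `N`
(`le_muHat_div_of_ksStat_le`, `le_inv_sqrt_mul_sum`). By the central limit theorem this has
asymptotic probability at most `q ^ N`, where `q < 1` is the Gaussian mass of `[-C, ∞)`
(`limsup_forall_ge_le`). Since `N` is arbitrary, the limit is zero. -/

theorem identDistrib_comp (hZ : ∀ i, Measurable (Z i)) (hlaw : ∀ i, μ.map (Z i) = P)
    {f : 𝒵 → ℝ} (hf : Measurable f) (i : ℕ) :
    IdentDistrib (fun ω => f (Z i ω)) (fun ω => f (Z 0 ω)) μ μ :=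
  IdentDistrib.comp (u := f)
    ⟨(hZ i).aemeasurable, (hZ 0).aemeasurable, by rw [hlaw, hlaw]⟩ hf

theorem iIndepFun_comp (hindep : iIndepFun Z μ) {f : 𝒵 → ℝ} (hf : Measurable f) :
    iIndepFun (fun i ω => f (Z i ω)) μ :=
  hindep.comp (fun _ => f) fun _ => hf

theorem integral_comp_law (hZ : ∀ i, Measurable (Z i)) (hlaw : ∀ i, μ.map (Z i) = P)
    {f : 𝒵 → ℝ} (hf : Measurable f) (i : ℕ) : ∫ ω, f (Z i ω) ∂μ = ∫ z, f z ∂P := by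
  rw [← hlaw i, integral_map (hZ i).aemeasurable hf.aestronglyMeasurable]

variable [IsProbabilityMeasure μ]

/-- The multivariate central limit theorem for orthonormal functions of i.i.d. observations. -/
theorem tendstoInDistribution_orthonormal (hZ : ∀ i, Measurable (Z i)) (hindep : iIndepFun Z μ)
    (hlaw : ∀ i, μ.map (Z i) = P) {N : ℕ} {F : Fin N → 𝒵 → ℝ} (hF : ∀ a, Measurable (F a))
    (hL2 : ∀ a, MemLp (F a) 2 P) (hmean : ∀ a, ∫ z, F a z ∂P = 0)
    (hcov : ∀ a b, ∫ z, F a z * F b z ∂P = if a = b then 1 else 0) :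
    TendstoInDistribution
      (fun (n : ℕ) ω => (WithLp.toLp 2 fun a =>
        (√(n : ℝ))⁻¹ * ∑ k ∈ Finset.range n, F a (Z k ω) : EuclideanSpace ℝ (Fin N)))
      atTop id (fun _ => μ) (stdGaussian (EuclideanSpace ℝ (Fin N))) where
  forall_aemeasurable n := by
    have : ∀ a k, Measurable fun ω => F a (Z k ω) := fun a k => (hF a).comp (hZ k)
    fun_prop
  tendsto := by
    have hP : IsProbabilityMeasure P := by
      rw [← hlaw 0]; exact Measure.isProbabilityMeasure_map (hZ 0).aemeasurable
    have hFZ : ∀ a k, Measurable fun ω => F a (Z k ω) := fun a k => (hF a).comp (hZ k)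
    -- Cramér–Wold: the characteristic function at `t` is that of the normalised sum of the scalar
    -- `φ = ∑ t a * F a` at `1`, and orthonormality gives `φ` variance `‖t‖ ^ 2`.
    refine ProbabilityMeasure.tendsto_iff_tendsto_charFun.2 fun (t : EuclideanSpace ℝ (Fin N)) => ?_
    set φ : 𝒵 → ℝ := fun z => ∑ a, t a * F a z with hφ
    have hφm : Measurable φ := by fun_prop
    have hφL : MemLp φ 2 P := memLp_finsetSum _ fun a _ => (hL2 a).const_mul _
    have hφ0 : ∫ z, φ z ∂P = 0 := by
      rw [hφ, integral_finsetSum _ fun a _ => ((hL2 a).integrable (by simp)).const_mul _]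
      simp [integral_const_mul, hmean]
    have hφ2 : ∫ z, φ z ^ 2 ∂P = ‖t‖ ^ 2 := by
      have h1 : ∀ z, φ z ^ 2 = ∑ a, ∑ b, (t a * t b) * (F a z * F b z) := fun z => by
        rw [hφ, sq, Finset.sum_mul_sum]
        exact Finset.sum_congr rfl fun a _ => Finset.sum_congr rfl fun b _ => by ring
      have hi : ∀ a b, Integrable (fun z => (t a * t b) * (F a z * F b z)) P := fun a b =>
        ((hL2 a).integrable_mul (hL2 b)).const_mul _
      simp_rw [h1]
      rw [integral_finsetSum _ fun a _ => integrable_finsetSum _ fun b _ => hi a b]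
      simp_rw [integral_finsetSum _ fun b _ => hi _ b, integral_const_mul, hcov]
      rw [EuclideanSpace.real_norm_sq_eq]
      simp [sq]
    have hvar : Var[fun ω => φ (Z 0 ω); μ] = ‖t‖ ^ 2 := by
      rw [variance_of_integral_eq_zero (X := fun ω => φ (Z 0 ω)) (hφm.comp (hZ 0)).aemeasurable
        (by rw [integral_comp_law hZ hlaw hφm, hφ0]),
        integral_comp_law hZ hlaw (f := fun z => φ z ^ 2) (hφm.pow_const 2), hφ2]
    have hmp : MemLp (fun ω => φ (Z 0 ω)) 2 μ := by
      rw [← hlaw 0] at hφL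
      exact hφL.comp_of_map (hZ 0).aemeasurable
    have key := tendstoInDistribution_inv_sqrt_mul_sum_sub (P := μ)
      (X := fun i ω => φ (Z i ω)) (Y := id)
      (P' := gaussianReal 0 Var[fun ω => φ (Z 0 ω); μ].toNNReal)
      HasLaw.id hmp (iIndepFun_comp hindep hφm)
      (identDistrib_comp hZ hlaw hφm)
    have key1 := ProbabilityMeasure.tendsto_iff_tendsto_charFun.1 key.tendsto 1
    simp only [ProbabilityMeasure.coe_mk, Measure.map_id] at key1 ⊢
    rw [charFun_stdGaussian]
    rw [charFun_gaussianReal, hvar] at key1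
    convert key1 using 2 with n
    · rw [charFun_apply, charFun_apply,
        integral_map (by fun_prop) (by fun_prop), integral_map (by fun_prop) (by fun_prop)]
      refine integral_congr_ae (.of_forall fun ω => ?_)
      have : inner ℝ (WithLp.toLp 2 fun a =>
          (√(n : ℝ))⁻¹ * ∑ k ∈ Finset.range n, F a (Z k ω) : EuclideanSpace ℝ (Fin N)) t
          = (√(n : ℝ))⁻¹ * ∑ k ∈ Finset.range n, φ (Z k ω) := by
        simp only [PiLp.inner_apply, RCLike.inner_apply, conj_trivial, hφ]
        rw [Finset.sum_comm, Finset.mul_sum]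
        refine Finset.sum_congr rfl fun a _ => ?_
        rw [← Finset.mul_sum]; ring
      simp only [this, integral_comp_law hZ hlaw hφm, hφ0]
      simp
    · have : (0:ℝ) ≤ ‖t‖ ^ 2 := by positivity
      simp [this]
      ring_nf

theorem stdGaussian_forall_ge (N : ℕ) (C : ℝ) :
    stdGaussian (EuclideanSpace ℝ (Fin N)) {x | ∀ a, -C ≤ x a}
      = gaussianReal 0 1 (Set.Ici (-C)) ^ N := by
  rw [← map_pi_eq_stdGaussian, Measure.map_apply (by fun_prop)
    (by simp only [Set.ofPred_forall]; exact MeasurableSet.iInter fun a =>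
      measurableSet_le measurable_const (by fun_prop))]
  have : WithLp.toLp 2 ⁻¹' {x : EuclideanSpace ℝ (Fin N) | ∀ a, -C ≤ x a}
      = Set.univ.pi fun _ => Set.Ici (-C) := by
    ext x; simp [Pi.le_def]
  rw [this, Measure.pi_pi]
  simp

/-- Lebesgue measure is absolutely continuous with respect to the Gaussian, so the complementary
half-line cannot be null. -/
theorem gaussianReal_Ici_lt_one (C : ℝ) : gaussianReal 0 1 (Set.Ici (-C)) < 1 := by
  refine lt_of_le_of_ne prob_le_one fun h => ?_
  rw [← prob_compl_eq_zero_iff measurableSet_Ici] at h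
  have := gaussianReal_absolutelyContinuous' 0 one_ne_zero h
  simp at this

/-- The probability that all of `N` normalised orthonormal sums exceed `-C` is asymptotically at
most the `N`-th power of a number smaller than one. -/
theorem limsup_forall_ge_le (hZ : ∀ i, Measurable (Z i)) (hindep : iIndepFun Z μ)
    (hlaw : ∀ i, μ.map (Z i) = P) {N : ℕ} {F : Fin N → 𝒵 → ℝ} (hF : ∀ a, Measurable (F a))
    (hL2 : ∀ a, MemLp (F a) 2 P) (hmean : ∀ a, ∫ z, F a z ∂P = 0)
    (hcov : ∀ a b, ∫ z, F a z * F b z ∂P = if a = b then 1 else 0) (C : ℝ) :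
    limsup (fun n : ℕ => μ {ω | ∀ a,
        -C ≤ (√(n : ℝ))⁻¹ * ∑ k ∈ Finset.range n, F a (Z k ω)}) atTop
      ≤ gaussianReal 0 1 (Set.Ici (-C)) ^ N := by
  have hclosed : IsClosed {x : EuclideanSpace ℝ (Fin N) | ∀ a, -C ≤ x a} := by
    simp only [Set.ofPred_forall]
    exact isClosed_iInter fun a => isClosed_le continuous_const (by fun_prop)
  have hT := tendstoInDistribution_orthonormal hZ hindep hlaw hF hL2 hmean hcov
  -- Portmanteau for a closed orthant, whose Gaussian mass factorises over the coordinates.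
  have h := ProbabilityMeasure.limsup_measure_closed_le_of_tendsto hT.tendsto hclosed
  simp only [ProbabilityMeasure.coe_mk, Measure.map_id, stdGaussian_forall_ge] at h
  refine le_of_eq_of_le ?_ h
  congr 1
  ext n
  rw [Measure.map_apply_of_aemeasurable (hT.forall_aemeasurable n) hclosed.measurableSet]
  rfl

/-- The sample variance converges in probability. -/
theorem tendstoInMeasure_sampleVariance (hZ : ∀ i, Measurable (Z i)) (hindep : iIndepFun Z μ)
    (hlaw : ∀ i, μ.map (Z i) = P) {f : 𝒵 → ℝ} (hf : Measurable f)
    (hL2 : MemLp f 2 P) (hmean : ∫ z, f z ∂P = 0) :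
    TendstoInMeasure μ (fun (n : ℕ) ω => sampleMean n (fun i => Z i ω) (fun z => f z ^ 2) -
      sampleMean n (fun i => Z i ω) f ^ 2) atTop (fun _ => ∫ z, f z ^ 2 ∂P) := by
  have hP : IsProbabilityMeasure P := by
    rw [← hlaw 0]; exact Measure.isProbabilityMeasure_map (hZ 0).aemeasurable
  have hfZ : ∀ k, Measurable fun ω => f (Z k ω) := fun k => hf.comp (hZ k)
  have slln : ∀ g : 𝒵 → ℝ, Measurable g → Integrable g P → ∀ᵐ ω ∂μ,
      Tendsto (fun n : ℕ => sampleMean n (fun i => Z i ω) g) atTop (𝓝 (∫ z, g z ∂P)) := by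
    intro g hg hgi
    have h := strong_law_ae_real (μ := μ) (fun i ω => g (Z i ω))
      (by rw [← hlaw 0] at hgi; exact hgi.comp_measurable (hZ 0))
      (fun i j hij => (iIndepFun_comp hindep hg).indepFun hij) (identDistrib_comp hZ hlaw hg)
    rwa [integral_comp_law hZ hlaw hg] at h
  refine tendstoInMeasure_of_tendsto_ae (fun n => ?_) ?_
  · unfold sampleMean; fun_prop
  filter_upwards [slln f hf (hL2.integrable (by simp)),
    slln (fun z => f z ^ 2) (hf.pow_const 2) hL2.integrable_sq] with ω h1 h2
  simpa [hmean] using h2.sub (h1.pow 2)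

end CentralLimit

/-! ### Moments of weighted functions on the contact set. -/

section WeightedMoments

variable {dX dW : ℕ} {P : Measure (Vec dX × Vec dW)} [IsProbabilityMeasure P] {f : Vec dW → ℝ}
  {g : Vec dX → ℝ≥0} {U : Set (Vec dX)} {v : Vec dX → ℝ}

/-- Disintegrate along `X`: the conditional mean vanishes on `U`, and the weight vanishes off `U`.
-/
theorem integral_mul_weight_eq_zero (hfi : Integrable (fun z : Vec dX × Vec dW => f z.2) P)
    (hg : Measurable g) {B : ℝ≥0} (hB : ∀ x, g x ≤ B) (hgU : Function.support g ⊆ U)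
    (hmean : ∀ᵐ x ∂P.fst, x ∈ U → condMean P f x = 0) :
    ∫ z, f z.2 * g z.1 ∂P = 0 := by
  have hi : Integrable (fun z : Vec dX × Vec dW => f z.2 * g z.1) P := by
    refine hfi.mul_bdd (c := B)
      (Measurable.aestronglyMeasurable (by fun_prop)) (.of_forall fun z => ?_)
    simpa using hB z.1
  rw [← Measure.integral_condKernel hi]
  refine integral_eq_zero_of_ae ?_
  filter_upwards [hmean] with x hx
  rw [integral_mul_const]
  by_cases hxU : x ∈ U
  · have := hx hxU
    rw [condMean] at this
    simp [this]
  · have : g x = 0 := by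
      by_contra h
      exact hxU (hgU h)
    simp [this]

/-- On `U`, the conditional second moment is the conditional variance. -/
theorem lintegral_sq_condKernel (hf : Measurable f)
    (hmean : ∀ᵐ x ∂P.fst, x ∈ U → condMean P f x = 0)
    (hvar : ∀ᵐ x ∂P.fst, x ∈ U → condVariance P f x = v x) (hv : ∀ x ∈ U, 0 < v x) :
    ∀ᵐ x ∂P.fst, x ∈ U →
      ∫⁻ w, ENNReal.ofReal (f w ^ 2) ∂(P.condKernel x) = ENNReal.ofReal (v x) := by
  filter_upwards [hmean, hvar] with x h0 h1 hxU
  specialize h0 hxU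
  specialize h1 hxU
  rw [condMean] at h0
  rw [condVariance] at h1
  -- `variance` takes the value `0` on functions outside `L²`, so a positive conditional variance
  -- forces square integrability.
  have hL : MemLp f 2 (P.condKernel x) :=
    memLp_two_of_variance_ne_zero hf.aestronglyMeasurable (by rw [h1]; exact (hv x hxU).ne')
  rw [← h1, variance_of_integral_eq_zero hf.aemeasurable h0,
    ofReal_integral_eq_lintegral_ofReal hL.integrable_sq (.of_forall fun w => sq_nonneg _)]

/-- Stated with `∫⁻` because square integrability is not yet known; `memLp_two_mul_weight` deduces
it from this identity. -/
theorem lintegral_sq_mul_weight (hf : Measurable f) (hg : Measurable g)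
    (hgU : Function.support g ⊆ U)
    (hmean : ∀ᵐ x ∂P.fst, x ∈ U → condMean P f x = 0)
    (hvar : ∀ᵐ x ∂P.fst, x ∈ U → condVariance P f x = v x) (hv : ∀ x ∈ U, 0 < v x) :
    ∫⁻ z, ENNReal.ofReal ((f z.2 * g z.1) ^ 2) ∂P
      = ∫⁻ x, (g x : ℝ≥0∞) ^ 2 * ENNReal.ofReal (v x) ∂P.fst := by
  rw [← Measure.lintegral_condKernel (by fun_prop)]
  refine lintegral_congr_ae ?_
  filter_upwards [lintegral_sq_condKernel hf hmean hvar hv] with x hx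
  have h1 : ∀ w, ENNReal.ofReal ((f w * g x) ^ 2)
      = (g x : ℝ≥0∞) ^ 2 * ENNReal.ofReal (f w ^ 2) := fun w => by
    rw [mul_pow, mul_comm, ENNReal.ofReal_mul (by positivity), ENNReal.ofReal_pow (by positivity),
      ENNReal.ofReal_coe_nnreal]
  simp only [h1]
  rw [lintegral_const_mul _ (by fun_prop)]
  by_cases hxU : x ∈ U
  · rw [hx hxU]
  · have : g x = 0 := by
      by_contra h
      exact hxU (hgU h)
    simp [this]

theorem memLp_two_mul_weight (hf : Measurable f) (hg : Measurable g) {B : ℝ≥0}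
    (hB : ∀ x, g x ≤ B) (hgU : Function.support g ⊆ U)
    (hmean : ∀ᵐ x ∂P.fst, x ∈ U → condMean P f x = 0)
    (hvar : ∀ᵐ x ∂P.fst, x ∈ U → condVariance P f x = v x) (hv : ∀ x ∈ U, 0 < v x)
    {b : ℝ} (hvb : ∀ x ∈ U, v x ≤ b) :
    MemLp (fun z : Vec dX × Vec dW => f z.2 * g z.1) 2 P := by
  rw [memLp_two_iff_integrable_sq (by fun_prop)]
  refine ⟨by fun_prop, ?_⟩
  rw [hasFiniteIntegral_iff_ofReal (.of_forall fun z => sq_nonneg _),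
    lintegral_sq_mul_weight hf hg hgU hmean hvar hv]
  calc ∫⁻ x, (g x : ℝ≥0∞) ^ 2 * ENNReal.ofReal (v x) ∂P.fst
      ≤ ∫⁻ _, (B : ℝ≥0∞) ^ 2 * ENNReal.ofReal b ∂P.fst := by
        refine lintegral_mono fun x => ?_
        by_cases hxU : x ∈ U
        · dsimp only
          gcongr
          · exact hB x
          · exact hvb x hxU
        · have : g x = 0 := by
            by_contra h
            exact hxU (hgU h)
          simp [this]
    _ < ∞ := by
        rw [lintegral_const]
        finiteness

/-- A zero second moment would make `g` vanish almost surely on `U`. The density is positive there,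
so `g` would vanish Lebesgue-a.e. on `U`, contradicting that it is nonzero on a nonempty open set.
-/
theorem integral_sq_mul_weight_pos (hf : Measurable f) (hg : Measurable g)
    (hgU : Function.support g ⊆ U) (hU : IsOpen U)
    (hmean : ∀ᵐ x ∂P.fst, x ∈ U → condMean P f x = 0)
    (hvar : ∀ᵐ x ∂P.fst, x ∈ U → condVariance P f x = v x) (hv : ∀ x ∈ U, 0 < v x)
    (hL2 : MemLp (fun z : Vec dX × Vec dW => f z.2 * g z.1) 2 P)
    {p : Vec dX → ℝ} (hp : Measurable p)
    (hdens : P.fst.restrict U = (volume.restrict U).withDensity fun x => ENNReal.ofReal (p x))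
    (hp0 : ∀ x ∈ U, 0 < p x) {x₀ : Vec dX} (hg0 : ∀ᶠ x in 𝓝 x₀, g x ≠ 0) :
    0 < ∫ z, (f z.2 * g z.1) ^ 2 ∂P := by
  refine lt_of_le_of_ne (integral_nonneg fun z => sq_nonneg _) fun h => ?_
  have h1 := ofReal_integral_eq_lintegral_ofReal hL2.integrable_sq
    (.of_forall fun z => sq_nonneg _)
  rw [← h, ← Measure.lintegral_condKernel (by fun_prop), ENNReal.ofReal_zero, eq_comm,
    lintegral_eq_zero_iff (by fun_prop)] at h1
  have h2 : ∀ᵐ x ∂P.fst, x ∈ U → g x = 0 := by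
    filter_upwards [h1, lintegral_sq_condKernel hf hmean hvar hv] with x h1 h2 hxU
    have h3 : ∀ w, ENNReal.ofReal ((f w * g x) ^ 2)
        = (g x : ℝ≥0∞) ^ 2 * ENNReal.ofReal (f w ^ 2) := fun w => by
      rw [mul_pow, mul_comm, ENNReal.ofReal_mul (by positivity), ENNReal.ofReal_pow (by positivity),
        ENNReal.ofReal_coe_nnreal]
    simp only [h3, Pi.zero_apply] at h1
    rw [lintegral_const_mul _ (by fun_prop), h2 hxU, mul_eq_zero] at h1
    rcases h1 with h1 | h1
    · simpa using h1
    · rw [ENNReal.ofReal_eq_zero] at h1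
      exact absurd (hv x hxU) h1.not_gt
  rw [← ae_restrict_iff' hU.measurableSet, hdens, ae_withDensity_iff (by fun_prop),
    ae_restrict_iff' hU.measurableSet] at h2
  obtain ⟨O, hO, hOo, hxO⟩ := eventually_nhds_iff.1 hg0
  refine (hOo.measure_pos volume ⟨x₀, hxO⟩).ne' (measure_mono_null (fun x hx => ?_) h2)
  have hxU := hgU (hO x hx)
  simpa [hxU, hp0 x hxU] using hO x hx

end WeightedMoments

/-! ### Disjoint balls and dilated kernels. -/

/-- A nonempty open subset of `ℝ^d`, `d ≥ 1`, contains any number of disjoint small balls of the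
same radius. -/
theorem exists_disjoint_balls {d : ℕ} (hd : 0 < d) {U : Set (Vec d)} (hU : IsOpen U)
    (hne : U.Nonempty) (N : ℕ) :
    ∃ x : Fin N → Vec d, ∃ r : ℝ, 0 < r ∧ (∀ a, Metric.ball (x a) r ⊆ U) ∧
      ∀ a b, a ≠ b → Disjoint (Metric.ball (x a) r) (Metric.ball (x b) r) := by
  -- In positive dimension no point is isolated, so a nonempty open set is infinite.
  have : NeZero d := ⟨hd.ne'⟩
  obtain ⟨x₀, hx₀⟩ := hne
  have hinf : U.Infinite := infinite_of_mem_nhds x₀ (hU.mem_nhds hx₀)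
  let e := hinf.natEmbedding
  have hinj : ∀ a b : Fin N, a ≠ b → (e a : Vec d) ≠ e b := fun a b hab h =>
    hab (Fin.ext (e.injective (Subtype.ext h)))
  have h1 : ∀ᶠ r in 𝓝[>] (0 : ℝ), ∀ a : Fin N, Metric.ball (e a : Vec d) r ⊆ U := by
    rw [eventually_all]
    intro a
    obtain ⟨ρ, hρ, hsub⟩ := Metric.isOpen_iff.1 hU _ (e a).2
    filter_upwards [Ioo_mem_nhdsGT hρ] with r hr
    exact (Metric.ball_subset_ball hr.2.le).trans hsub
  have h2 : ∀ᶠ r in 𝓝[>] (0 : ℝ), ∀ a b : Fin N, a ≠ b →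
      Disjoint (Metric.ball (e a : Vec d) r) (Metric.ball (e b : Vec d) r) := by
    simp only [eventually_all]
    intro a b hab
    filter_upwards [Ioo_mem_nhdsGT (half_pos (dist_pos.2 (hinj a b hab)))] with r hr
    exact Metric.ball_disjoint_ball (by linarith [hr.2])
  obtain ⟨r, ⟨h1, h2⟩, hr⟩ := ((h1.and h2).and self_mem_nhdsWithin).exists
  exact ⟨fun a => e a, r, hr, h1, h2⟩

/-- If `k` has bounded support, small dilations of `k` are supported in a given ball. -/
theorem exists_support_dilation_subset {d : ℕ} {k : Vec d → ℝ≥0}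
    (hk : Bornology.IsBounded (Function.support k)) {r : ℝ} (hr : 0 < r) {h₀ : ℝ} (h₀pos : 0 < h₀) :
    ∃ h : ℝ, 0 < h ∧ h < h₀ ∧
      ∀ x, Function.support (fun t => k (h⁻¹ • (t - x))) ⊆ Metric.ball x r := by
  obtain ⟨R, hR0, hR⟩ := hk.subset_ball_lt 0 0
  -- The first entry gives `h < h₀`, the second `h * R ≤ r`, where `R` is a radius enclosing the
  -- support of `k`.
  refine ⟨min (h₀ / 2) (r / R), by positivity, (min_le_left _ _).trans_lt (by linarith),
    fun x t ht => ?_⟩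
  set h := min (h₀ / 2) (r / R) with hh
  have hpos : 0 < h := by positivity
  have h1 := hR ht
  rw [mem_ball_zero_iff, norm_smul, norm_inv, Real.norm_of_nonneg hpos.le,
    inv_mul_lt_iff₀ hpos] at h1
  rw [mem_ball_iff_norm]
  calc ‖t - x‖ < h * R := h1
    _ ≤ r / R * R := by gcongr; exact min_le_right _ _
    _ = r := by field_simp

/-! ### From the statistic to orthonormal sums. -/

section Statistic

variable {dX dW dY d : ℕ} {Θ : Set (Vec d)} {m : Vec dW × Θ → Fin dY → ℝ}
  {G : Set (Vec dX → Fin dY → ℝ≥0)} {S : (Fin dY → ℝ) → ℝ≥0} {θ : Θ}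

theorem sampleMean_const_mul {𝒵 : Type*} (n : ℕ) (z : ℕ → 𝒵) (c : ℝ) (f : 𝒵 → ℝ) :
    sampleMean n z (fun p => c * f p) = c * sampleMean n z f := by
  simp only [sampleMean, ← Finset.mul_sum, mul_div_assoc]

/-- A bound on the statistic bounds every weighted moment from below. -/
theorem le_muHat_div_of_ksStat_le {K₂ : ℝ}
    (hS : ∀ c : ℝ, 0 < c → ∀ t, (S t : ℝ) ≤ c → ∀ j, -(c * K₂) ≤ t j)
    {M : ℝ} (hM : 0 < M) {n : ℕ} (hn : 0 < n) {z : ℕ → Vec dX × Vec dW} {s : ℝ}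
    (h : ENNReal.ofReal (√n) * ksStat m G S s n z θ ≤ ENNReal.ofReal M)
    {g : Vec dX → Fin dY → ℝ≥0} (hg : g ∈ G) (j : Fin dY) :
    -(M / √n * K₂) ≤ muHat m n z θ g j / max (sigmaHat m n z θ g j) s := by
  have hsn : 0 < √(n : ℝ) := Real.sqrt_pos.2 (by exact_mod_cast hn)
  refine hS (M / √n) (by positivity)
    (fun j => muHat m n z θ g j / max (sigmaHat m n z θ g j) s) ?_ j
  rw [le_div_iff₀' hsn]
  have h1 := (mul_le_mul_right (le_iSup₂_of_le (f := fun g (_ : g ∈ G) =>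
    (S (fun j => muHat m n z θ g j / max (sigmaHat m n z θ g j) s) : ℝ≥0∞)) g hg le_rfl)
    (ENNReal.ofReal (√n))).trans h
  rw [← ENNReal.ofReal_coe_nnreal, ← ENNReal.ofReal_mul hsn.le,
    ENNReal.ofReal_le_ofReal_iff hM.le] at h1
  exact h1

/-- On the event that the sample variance is close to its limit and the truncation point is small,
a lower bound on the weighted moment is a lower bound on the normalised sum. -/
theorem le_inv_sqrt_mul_sum {c : ℝ} (hc : 0 ≤ c) {n : ℕ} (hn : 0 < n)
    {z : ℕ → Vec dX × Vec dW} {s ς : ℝ} (hς : 0 < ς) (hs : s ≤ 2 * ς)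
    {g : Vec dX → Fin dY → ℝ≥0} {j : Fin dY} {Y : Vec dX × Vec dW → ℝ}
    (hY : ∀ p : Vec dX × Vec dW, m (p.2, θ) j * g p.1 j = ς * Y p)
    (hV : |sampleMean n z (fun p => Y p ^ 2) - sampleMean n z Y ^ 2 - 1| < 1 / 2)
    (h : -(c / √n) ≤ muHat m n z θ g j / max (sigmaHat m n z θ g j) s) :
    -(2 * c) ≤ (√(n : ℝ))⁻¹ * ∑ k ∈ Finset.range n, Y (z k) := by
  have hsn : 0 < √(n : ℝ) := Real.sqrt_pos.2 (by exact_mod_cast hn)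
  rw [abs_lt] at hV
  set V := sampleMean n z (fun p => Y p ^ 2) - sampleMean n z Y ^ 2 with hVdef
  have hmu : muHat m n z θ g j = ς * sampleMean n z Y := by
    simp only [muHat, hY, sampleMean_const_mul]
  have hsig : sigmaHat m n z θ g j = ς * √V := by
    simp only [sigmaHat, hY, mul_pow, sampleMean_const_mul]
    rw [← mul_sub, Real.sqrt_mul (sq_nonneg _), Real.sqrt_sq hς.le]
  have hV0 : 0 < √V := Real.sqrt_pos.2 (by linarith)
  have hV2 : √V ≤ 2 := Real.sqrt_le_iff.2 ⟨by norm_num, by linarith⟩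
  set D := max (sigmaHat m n z θ g j) s with hD
  -- The truncation point `s` may be nonpositive; positivity comes from the sample variance.
  have hD0 : 0 < D := lt_max_of_lt_left (by rw [hsig]; positivity)
  have hD2 : D ≤ 2 * ς := max_le (by rw [hsig]; nlinarith) hs
  rw [le_div_iff₀ hD0, hmu] at h
  -- The lower bound is nonpositive, so replacing `D` by the larger `2 * ς` only weakens it.
  have h1 : -(c / √n) * (2 * ς) ≤ ς * sampleMean n z Y := by
    refine le_trans ?_ h
    rw [neg_mul, neg_mul, neg_le_neg_iff]
    gcongr
  have h2 : -(c / √n) * 2 ≤ sampleMean n z Y := by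
    refine le_of_mul_le_mul_left ?_ hς
    linarith
  have h3 : (√(n : ℝ))⁻¹ * ∑ k ∈ Finset.range n, Y (z k) = √n * sampleMean n z Y := by
    rw [sampleMean]
    nth_rewrite 3 [← Real.sq_sqrt (Nat.cast_nonneg n)]
    field_simp
  rw [h3]
  calc -(2 * c) = √n * (-(c / √n) * 2) := by field_simp
    _ ≤ _ := by gcongr

/-- Under the contact set condition, there are arbitrarily many weights in the class whose weighted
moments are proportional to orthonormal functions of an observation. -/
theorem ContactSetAt.exists_orthonormal {P : Measure (Vec dX × Vec dW)} [IsProbabilityMeasure P]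
    {j : Fin dY} {U : Set (Vec dX)} (h : ContactSetAt P m G θ j U) (hdX : 0 < dX)
    (hm : Measurable m) (hint : Integrable (fun z : Vec dX × Vec dW => m (z.2, θ) j) P) (N : ℕ) :
    ∃ (g : Fin N → Vec dX → Fin dY → ℝ≥0) (ς : Fin N → ℝ) (Y : Fin N → Vec dX × Vec dW → ℝ),
      (∀ a, g a ∈ G) ∧ (∀ a, 0 < ς a) ∧
      (∀ a (p : Vec dX × Vec dW), m (p.2, θ) j * g a p.1 j = ς a * Y a p) ∧
      (∀ a, Measurable (Y a)) ∧ (∀ a, MemLp (Y a) 2 P) ∧ (∀ a, ∫ z, Y a z ∂P = 0) ∧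
      ∀ a b, ∫ z, Y a z * Y b z ∂P = if a = b then 1 else 0 := by
  obtain ⟨k, hk, h₀, h₀pos, hkG⟩ := h.kernel_mem
  obtain ⟨x, r, hr, hxU, hdisj⟩ := exists_disjoint_balls hdX h.isOpen h.nonempty N
  obtain ⟨η, hη, hηh, hsupp⟩ := exists_support_dilation_subset hk.bounded_support hr h₀pos
  choose g hgG hg using fun a => hkG (x a) η hη hηh
  obtain ⟨B, hB⟩ := hk.bounded
  obtain ⟨p, hp, hdens, p₁, p₂, hp₁, hpb⟩ := h.density
  obtain ⟨v, -, hvar, v₁, v₂, hv₁, hvb⟩ := h.condVar_bounds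
  have hv : ∀ y ∈ U, 0 < v y := fun y hy => hv₁.trans_le (hvb y hy).1
  have hf : Measurable fun w => m (w, θ) j := by fun_prop
  set w : Fin N → Vec dX → ℝ≥0 := fun a t => k (η⁻¹ • (t - x a)) with hw
  have hwm : ∀ a, Measurable (w a) := fun a => hk.measurable.comp (by fun_prop)
  have hwU : ∀ a, Function.support (w a) ⊆ U := fun a => (hsupp (x a)).trans (hxU a)
  have hw0 : ∀ a, ∀ᶠ y in 𝓝 (x a), w a y ≠ 0 := fun a => by
    obtain ⟨δ, hδ, hkδ⟩ := hk.bounded_below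
    have ht : Tendsto (fun y => η⁻¹ • (y - x a)) (𝓝 (x a)) (𝓝 0) := by
      have : Continuous fun y => η⁻¹ • (y - x a) := by fun_prop
      simpa using this.tendsto (x a)
    filter_upwards [ht.eventually hkδ] with y hy
    exact (hδ.trans_le hy).ne'
  set F : Fin N → Vec dX × Vec dW → ℝ := fun a z => m (z.2, θ) j * w a z.1 with hF
  have hFm : ∀ a, Measurable (F a) := fun a => by
    have := hwm a
    fun_prop
  have hF2 : ∀ a, MemLp (F a) 2 P := fun a =>
    memLp_two_mul_weight hf (hwm a) (fun _ => hB _) (hwU a) h.condMean_eq_zero hvar hv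
      fun y hy => (hvb y hy).2
  have hFpos : ∀ a, 0 < ∫ z, F a z ^ 2 ∂P := fun a =>
    integral_sq_mul_weight_pos hf (hwm a) (hwU a) h.isOpen h.condMean_eq_zero hvar hv (hF2 a) hp
      hdens (fun y hy => hp₁.trans_le (hpb y hy).1) (hw0 a)
  set ς : Fin N → ℝ := fun a => √(∫ z, F a z ^ 2 ∂P) with hς
  have hςpos : ∀ a, 0 < ς a := fun a => Real.sqrt_pos.2 (hFpos a)
  refine ⟨g, ς, fun a z => (ς a)⁻¹ * F a z, hgG, hςpos, fun a q => ?_, fun a => ?_, fun a => ?_,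
    fun a => ?_, fun a b => ?_⟩
  · have := (hςpos a).ne'
    rw [hg, mul_inv_cancel_left₀ this]
  · have := hFm a
    fun_prop
  · exact (hF2 a).const_mul _
  · rw [integral_const_mul,
      integral_mul_weight_eq_zero hint (hwm a) (fun _ => hB _) (hwU a) h.condMean_eq_zero, mul_zero]
  · split_ifs with hab
    · subst hab
      have h1 : ∀ z, (ς a)⁻¹ * F a z * ((ς a)⁻¹ * F a z) = (ς a ^ 2)⁻¹ * F a z ^ 2 := fun z => by
        ring
      simp_rw [h1]
      rw [integral_const_mul, hς, Real.sq_sqrt (hFpos a).le, inv_mul_cancel₀ (hFpos a).ne']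
    -- The product vanishes pointwise, since the two weights live on disjoint balls.
    · refine integral_eq_zero_of_ae (.of_forall fun z => ?_)
      have : w a z.1 = 0 ∨ w b z.1 = 0 := by
        by_contra! hne
        exact Set.disjoint_left.1 (hdisj a b hab) (hsupp (x a) hne.1) (hsupp (x b) hne.2)
      rcases this with h1 | h1 <;> simp [hF, h1]

end Statistic

end MomentIneq

/-! ### Divergence of the statistic. -/

theorem mainTheorem12 {dX dW dY d : ℕ} (hdX : 0 < dX)
    (Θ : Set (MomentIneq.Vec d))
    (m : MomentIneq.Vec dW × Θ → Fin dY → ℝ) (hm : Measurable m)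
    (P : Measure (MomentIneq.Vec dX × MomentIneq.Vec dW)) [IsProbabilityMeasure P]
    (G : Set (MomentIneq.Vec dX → Fin dY → ℝ≥0))
    (S : (Fin dY → ℝ) → ℝ≥0) (hS : MomentIneq.SAssumption S)
    (θ : Θ) (hθ : MomentIneq.ContactSetAssumption P m G θ)
    {Ω : Type*} [MeasurableSpace Ω] (μ : Measure Ω) [IsProbabilityMeasure μ]
    (Z : ℕ → Ω → MomentIneq.Vec dX × MomentIneq.Vec dW)
    (hZ : ∀ i, Measurable (Z i)) (hindep : iIndepFun Z μ) (hlaw : ∀ i, μ.map (Z i) = P)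
    (σ : ℕ → Ω → ℝ) (hσ : TendstoInMeasure μ σ atTop (fun _ => 0)) :
    ∀ M : ℝ, Tendsto
      (fun n : ℕ => μ {ω | ENNReal.ofReal (Real.sqrt n) *
        MomentIneq.ksStat m G S (σ n ω) n (fun i => Z i ω) θ ≤ ENNReal.ofReal M})
      atTop (𝓝 0) := by
  obtain ⟨hid, j, U, hC⟩ := hθ
  obtain ⟨K₁, K₂, -, hK₂, hscale⟩ := hS.scale
  intro M
  -- The scale condition on `S` needs a positive level; raising `M` only enlarges the event.
  set M' := max M 1 with hM'
  have hM'pos : 0 < M' := lt_max_of_lt_right one_pos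
  set C := 2 * (M' * K₂) with hCdef
  rw [ENNReal.tendsto_nhds_zero]
  intro ε hε
  have hq := MomentIneq.gaussianReal_Ici_lt_one C
  -- `C` is fixed before `N`, so `N` can be taken large enough for `q ^ N < ε / 2`.
  obtain ⟨N, hN⟩ := ((ENNReal.tendsto_pow_atTop_nhds_zero_of_lt_one hq).eventually_lt_const
    (ENNReal.half_pos hε.ne')).exists
  obtain ⟨g, ς, Y, hgG, hς, hgY, hYm, hY2, hY0, hYcov⟩ :=
    hC.exists_orthonormal hdX hm (hid j).1 N
  have hA := eventually_lt_of_limsup_lt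
    ((MomentIneq.limsup_forall_ge_le hZ hindep hlaw hYm hY2 hY0 hYcov C).trans_lt hN)
  set B₁ : Fin N → ℕ → Set Ω := fun a n => {ω | 1 / 2 ≤ |MomentIneq.sampleMean n (fun i => Z i ω)
    (fun z => Y a z ^ 2) - MomentIneq.sampleMean n (fun i => Z i ω) (Y a) ^ 2 - 1|} with hB₁
  set B₂ : Fin N → ℕ → Set Ω := fun a n => {ω | ς a ≤ |σ n ω|} with hB₂
  have hB : Tendsto (fun n => ∑ a, (μ (B₁ a n) + μ (B₂ a n))) atTop (𝓝 0) := by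
    rw [← Finset.sum_const_zero (s := (Finset.univ : Finset (Fin N)))]
    refine tendsto_finsetSum _ fun a _ => ?_
    rw [← add_zero (0 : ℝ≥0∞)]
    refine Tendsto.add ?_ ?_
    · have h1 := tendstoInMeasure_iff_norm.1 (MomentIneq.tendstoInMeasure_sampleVariance hZ hindep
        hlaw (hYm a) (hY2 a) (hY0 a)) (1 / 2) (by norm_num)
      have h2 : ∫ z, Y a z ^ 2 ∂P = 1 := by simpa [sq] using hYcov a a
      simpa only [h2, Real.norm_eq_abs] using h1
    · simpa only [sub_zero, Real.norm_eq_abs] using tendstoInMeasure_iff_norm.1 hσ (ς a) (hς a)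
  filter_upwards [hA, hB.eventually_lt_const (ENNReal.half_pos hε.ne'), eventually_gt_atTop 0]
    with n hAn hBn hn
  -- Only monotonicity and subadditivity of `μ` are used, so the event need not be measurable.
  calc _ ≤ μ ({ω | ∀ a, -C ≤ (√(n : ℝ))⁻¹ * ∑ k ∈ Finset.range n, Y a (Z k ω)} ∪
        ⋃ a, (B₁ a n ∪ B₂ a n)) := by
        refine measure_mono fun ω hω => ?_
        by_cases hbad : ω ∈ ⋃ a, (B₁ a n ∪ B₂ a n)
        · exact .inr hbad
        · simp only [Set.mem_iUnion, Set.mem_union, not_exists, not_or, hB₁, hB₂,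
            Set.mem_ofPred_eq, not_le] at hbad
          refine .inl fun a => ?_
          refine MomentIneq.le_inv_sqrt_mul_sum (s := σ n ω) (by positivity) hn (hς a)
            (by linarith [le_abs_self (σ n ω), (hbad a).2, hς a]) (hgY a) (hbad a).1 ?_
          have := MomentIneq.le_muHat_div_of_ksStat_le (fun c hc t => (hscale c hc t).2) hM'pos hn
            (le_trans hω (ENNReal.ofReal_le_ofReal (le_max_left M 1))) (hgG a) j
          rwa [div_mul_eq_mul_div] at this
    _ ≤ ε / 2 + ε / 2 := by
        refine (measure_union_le _ _).trans (add_le_add hAn.le ?_)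
        refine (measure_iUnion_fintype_le _ _).trans (le_trans ?_ hBn.le)
        exact Finset.sum_le_sum fun a _ => measure_union_le _ _
    _ = ε := ENNReal.add_halves ε
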